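/- \textbf{Setting.} Let $\mathring\Phi$ be an irreducible, reduced, crystallographic finite root system in a real vector space $V$ which is not simply laced (that is, of type $B_n$ $(n\ge 2)$, $C_n$ $(n\ge 3)$, $F_4$ or $G_2$), with short roots $\mathring\Phi_s$, long roots $\mathring\Phi_\ell$, and invariant form $(\cdot,\cdot)$. Let $m$ be the ratio of the squared lengths of long and short roots, so $m=3$ for $G_2$ and $m=2$ otherwise. Let $$\Phi=\{\alpha+r\delta:\alpha\in\mathring\Phi_s,\ r\in\mathbb Z\}\cup\{\alpha+mr\delta:\alpha\in\mathring\Phi_\ell,\ r\in\mathbb Z\}\subset V\oplus\mathbb R\delta ,$$ the set of real roots of the twisted affine Kac--Moody algebra of type $D_{n+1}^{(2)}$, $A_{2n-1}^{(2)}$, $E_6^{(2)}$, $D_4^{(3)}$ respectively (these are all twisted affine types other than $A_{2n}^{(2)}$). Extend $(\cdot,\cdot)$ to $V\oplus\mathbb R\delta$ with $\delta$ in the radical; put $\langle\beta,\alpha^\vee\rangle=2(\beta,\alpha)/(\alpha,\alpha)$ and $s_\alpha(\beta)=\beta-\langle\beta,\alpha^\vee\rangle\alpha$. Let $R$ be $\Phi$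 or $\mathring\Phi$. A non-empty subset $\Psi\subseteq R$ is a \emph{closed subroot system} of $R$ if $s_\alpha(\beta)\in\Psi$ for all $\alpha,\beta\in\Psi$, and $\alpha+\beta\in\Psi$ whenever $\alpha,\beta\in\Psi$ and $\alpha+\beta\in R$. It is \emph{maximal closed} if $\Psi\ne R$ and the only closed subroot system $\Delta$ of $R$ with $\Psi\subseteq\Delta\subsetneq R$ is $\Delta=\Psi$. For $\Psi\subseteq\Phi$ put $\mathrm{Gr}(\Psi)=\{\alpha\in\mathring\Phi:\alpha+r\delta\in\Psi\text{ for some }r\}$; for $\mathring\Psi\subseteq\mathring\Phi$ let its lift be $\widehat{\mathring\Psi}=\{\alpha+r\delta\in\Phi:\alpha\in\mathring\Psi\}$. A function $p:\mathring\Phi\to\mathbb Z$, $\alpha\mapsto p_\alpha$, is \emph{$\mathbb Z$-linear} if it is the restriction of a homomorphism from the root lattice $\mathbb Z\mathring\Phi$ to $\mathbb Z$. Consider the condition $$p_\beta-\langle\beta,\alpha^\vee\rangle p_\alpha=p_{s_\alpha(\beta)}\quad\text{for all }\alpha,\beta\in\mathring\Phi.\tag{$*$}$$ \textbf{Theorem.}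 \begin{enumerate} \item Let $\Psi$ be a maximal closed subroot system of $\Phi$ with $\mathrm{Gr}(\Psi)=\mathring\Phi$. Then there exist a $\mathbb Z$-linear function $p:\mathring\Phi\to\mathbb Z$ satisfying $(*)$ with $p_\alpha\in m\mathbb Z$ for all $\alpha\in\mathring\Phi_\ell$, and a prime number $n_\Psi$, such that $$\Psi=\begin{cases}\{\alpha+(p_\alpha+rn_\Psi)\delta,\ \beta+(p_\beta+mrn_\Psi)\delta:\alpha\in\mathring\Phi_s,\ \beta\in\mathring\Phi_\ell,\ r\in\mathbb Z\}&\text{if }n_\Psi\ne m,\\ \{\alpha+(p_\alpha+rn_\Psi)\delta:\alpha\in\mathring\Phi,\ r\in\mathbb Z\}&\text{if }n_\Psi=m.\end{cases}$$ Conversely, for every prime $n_\Psi$ and every $\mathbb Z$-linear $p:\mathring\Phi\to\mathbb Z$ satisfying $(*)$ and $p_\alpha\in m\mathbb Z$ for all $\alpha\in\mathring\Phi_\ell$, the set $\Psi$ defined by this formula is a maximal closed subroot system of $\Phi$ (and $\mathrm{Gr}(\Psi)=\mathring\Phi$). \item Let $\Psi$ be a maximal closed subroot system of $\Phi$ such that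 $\mathrm{Gr}(\Psi)\subsetneq\mathring\Phi$ is a proper closed subroot system of $\mathring\Phi$. Then $\mathrm{Gr}(\Psi)$ is a maximal closed subroot system of $\mathring\Phi$, it contains at least one short root, and $\Psi=\widehat{\mathrm{Gr}(\Psi)}$. Conversely, if $\mathring\Psi$ is a maximal closed subroot system of $\mathring\Phi$ containing a short root, then $\widehat{\mathring\Psi}$ is a maximal closed subroot system of $\Phi$. \end{enumerate} -/

import Mathlib

noncomputable section

namespace AffRoot

section General

variable {M : Type*} [AddCommGroup M] [Module ℝ M]

/-- The reflection `s_a(x) = x - ⟨x, a^∨⟩ a` with `⟨x, a^∨⟩ = 2 (x, a) / (a, a)`, for a symmetric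
bilinear form `B = ( , )` and a vector `a` with `(a, a) ≠ 0`. -/
def reflect (B : LinearMap.BilinForm ℝ M) (a x : M) : M :=
  x - (2 * B x a / B a a) • a

/-- `S` is a non-empty subset of `R` stable under the reflections in its own elements. (Properness
is imposed separately, where it is needed.) -/
structure IsSubrootSystem (B : LinearMap.BilinForm ℝ M) (R S : Set M) : Prop where
  nonempty : S.Nonempty
  subset : S ⊆ R
  refl_mem : ∀ a ∈ S, ∀ b ∈ S, reflect B a b ∈ S

/-- `S` is closed in `R`. -/
def IsClosedIn (R S : Set M) : Prop :=
  ∀ a ∈ S, ∀ b ∈ S, a + b ∈ R → a + b ∈ S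

/-- `S` is a closed subroot system of `R`. -/
def IsClosedSubrootSystem (B : LinearMap.BilinForm ℝ M) (R S : Set M) : Prop :=
  IsSubrootSystem B R S ∧ IsClosedIn R S

/-- `S` is a maximal closed subroot system of `R`: a proper closed subroot system such that every
proper closed subroot system containing it equals it. -/
def IsMaximalClosed (B : LinearMap.BilinForm ℝ M) (R S : Set M) : Prop :=
  IsClosedSubrootSystem B R S ∧ S ≠ R ∧
    ∀ D : Set M, IsClosedSubrootSystem B R D → S ⊆ D → D ≠ R → D = S

end General

variable {ι V N : Type*} [Fintype ι] [AddCommGroup V] [Module ℝ V] [AddCommGroup N] [Module ℝ N]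

/-- The set of roots of the finite root system `P`. -/
def finiteRoots (P : RootPairing ι ℝ V N) : Set V := Set.range P.root

/-- `P.root i` has minimal length among the roots. -/
def IsShort (P : RootPairing ι ℝ V N) (i : ι) : Prop :=
  ∀ j, P.RootForm (P.root i) (P.root i) ≤ P.RootForm (P.root j) (P.root j)

/-- `P.root i` has maximal length among the roots. -/
def IsLong (P : RootPairing ι ℝ V N) (i : ι) : Prop :=
  ∀ j, P.RootForm (P.root j) (P.root j) ≤ P.RootForm (P.root i) (P.root i)

/-- `m > 1` is the ratio of the squared length of a long root to that of a short root. For an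
irreducible reduced crystallographic `P` such an `m` exists precisely when `P` is not simply laced:
then `m = 3` if `P` is of type `G₂`, and `m = 2` if `P` is of type `Bₙ` (`n ≥ 2`), `Cₙ` (`n ≥ 3`)
or `F₄`. -/
def IsTwist (P : RootPairing ι ℝ V N) (m : ℕ) : Prop :=
  1 < m ∧ ∀ i j, IsLong P i → IsShort P j →
    P.RootForm (P.root i) (P.root i) = m * P.RootForm (P.root j) (P.root j)

/-- The invariant form on `V ⊕ ℝδ`, whose radical is `ℝδ`. The element `v + r δ` is represented by
`(v, r) : V × ℝ`. -/
def affineForm (P : RootPairing ι ℝ V N) : LinearMap.BilinForm ℝ (V × ℝ) :=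
  P.RootForm.compl₁₂ (LinearMap.fst ℝ V ℝ) (LinearMap.fst ℝ V ℝ)

/-- The real roots of the twisted affine root system attached to `P` and its twist number `m`:
`α + r δ` for `α` short and `r ∈ ℤ`, and `α + m r δ` for `α` long and `r ∈ ℤ`. The types
`Bₙ`, `Cₙ`, `F₄`, `G₂` of `P` give the affine types `D_{n+1}^{(2)}`, `A_{2n-1}^{(2)}`,
`E_6^{(2)}`, `D_4^{(3)}`. -/
def realRoots (P : RootPairing ι ℝ V N) (m : ℕ) : Set (V × ℝ) :=
  {x | ∃ (i : ι) (r : ℤ), IsShort P i ∧ x = (P.root i, (r : ℝ))} ∪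
  {x | ∃ (i : ι) (r : ℤ), IsLong P i ∧ x = (P.root i, (m : ℝ) * (r : ℝ))}

/-- The gradient `Gr(S)`: the set of all `α` with `α + r δ ∈ S` for some `r`. -/
def gradient (S : Set (V × ℝ)) : Set V := Prod.fst '' S

/-- The lift of a set `S` of finite roots: all `α + r δ` in the affine root system with `α ∈ S`. -/
def lift (P : RootPairing ι ℝ V N) (m : ℕ) (S : Set V) : Set (V × ℝ) :=
  {x | x ∈ realRoots P m ∧ x.1 ∈ S}

/-- `p : α ↦ p_α` is the restriction to the roots of a `ℤ`-linear map on the root lattice. -/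
def IsZLinear (P : RootPairing ι ℝ V N) (p : ι → ℤ) : Prop :=
  ∃ f : Submodule.span ℤ (Set.range P.root) →ₗ[ℤ] ℤ,
    ∀ i, p i = f ⟨P.root i, Submodule.subset_span (Set.mem_range_self i)⟩

/-- `p_β - ⟨β, α^∨⟩ p_α = p_{s_α(β)}` for all roots `α = P.root i`, `β = P.root j`. -/
def IsReflCompatible (P : RootPairing ι ℝ V N) [P.IsCrystallographic] (p : ι → ℤ) : Prop :=
  ∀ i j, p j - P.pairingIn ℤ j i * p i = p (P.reflectionPerm i j)

/-- The set of real roots given by `p` and the number `n`: if `m ≠ n`, short roots have period `n`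
and long roots have period `m n`; if `m = n`, all roots have period `n`. -/
def periodicRoots (P : RootPairing ι ℝ V N) (m : ℕ) (p : ι → ℤ) (n : ℕ) : Set (V × ℝ) :=
  if m = n then
    {x | ∃ (i : ι) (r : ℤ), x = (P.root i, (p i : ℝ) + r * n)}
  else
    {x | ∃ (i : ι) (r : ℤ), IsShort P i ∧ x = (P.root i, (p i : ℝ) + r * n)} ∪
    {x | ∃ (i : ι) (r : ℤ), IsLong P i ∧ x = (P.root i, (p i : ℝ) + m * r * n)}

end AffRoot

end

/-!
A closed subroot system `Ψ` of the affine root system is encoded by the family `Z` of the sets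
`Z i = {k | P.root i + k δ ∈ Ψ}` of integers. Throughout, the root system is treated uniformly: the
only input on its type is that there are short roots `i`, `j` whose sum `k` is long, with
`⟨i, k^∨⟩ = 1` and `⟨j, i^∨⟩ = m - 2` where `m` is `2` or `3` (`IsTwist.exists_short_add_short`), and
that roots of equal length are conjugate (`of_rootForm_eq`).

*Gradient everything.* If every `Z i` is non-empty, choose an element of `Z i` for the simple roots
`i` and extend linearly to `p`; since `Z` is stable under reflections, `p i ∈ Z i` for all `i`
(`IsClosedLevel.exists_isZLinear`). Translating by `p` reduces to the case `0 ∈ Z i` for all `i`.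
Then `Z i` only depends on the length of `i`, the set for the short roots is a subgroup `d ℤ` of `ℤ`,
and the one for the long roots is `d ℤ ∩ m ℤ` (`IsClosedLevel.exists_dvd_iff`). So the closed
subroot systems with full gradient are the sets of all real roots `α + k δ` with `k ≡ p α` modulo
`d`. They are ordered by divisibility of `d`, hence the maximal ones are those with `d` prime. For
`d = n` prime this is the set in the theorem, as `m` is prime: `n ℤ ∩ m ℤ` is `m n ℤ` if `n ≠ m`, and
`n ℤ` otherwise (`IsTwist.periodicRoots_eq`).

*Proper gradient.* If the gradient is closed and proper, its lift is a proper closed subroot system,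
so it equals `Ψ` by maximality. A gradient without short roots is excluded since the lift of
the long roots lies in the proper closed subroot system of all `α + k δ` with `m ∣ k`
(`isMaximal_gradient`).

*Lifts.* Let `I` be maximal closed with a short root, and let `Z` be closed, proper, and contain
the lift of `I`. The roots all of whose translates belong to `Z` form a closed set, which is `I` by
maximality. Any other root occurring in `Z` turns out to be strongly orthogonal to all short
roots of `I`. The roots with this property form a closed set `C`, and `I ∪ C` is closed with `I \ C`
orthogonal to `C`; since the root system is irreducible, maximality of `I` gives `C ⊆ I`
(`strongOrthogonal_subset`), so that `Z` is the lift of `I` (`IsClosedLevel.eq_liftLevel`).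
-/

namespace AffRoot

variable {ι V N : Type*} [Fintype ι] [AddCommGroup V] [Module ℝ V] [AddCommGroup N] [Module ℝ N]
  {P : RootPairing ι ℝ V N} {m : ℕ}

/-! ### Root lengths -/

section Lengths

lemma rootForm_self_pos (i : ι) : 0 < P.RootForm (P.root i) (P.root i) :=
  P.rootForm_pos_of_ne_zero (Submodule.subset_span (Set.mem_range_self i)) (P.ne_zero i)

lemma rootForm_comm (x y : V) : P.RootForm x y = P.RootForm y x := by
  simpa using P.rootForm_symmetric.eq x y

lemma reflect_rootForm (i : ι) (x : V) : reflect P.RootForm (P.root i) x = P.reflection i x := by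
  have h := P.rootForm_self_smul_coroot i
  have h2 : 2 * P.RootForm x (P.root i) = P.RootForm (P.root i) (P.root i) * P.coroot' i x := by
    have := congrArg (fun c => P.toLinearMap x c) h
    simp only [map_smul, map_nsmul, P.toLinearMap_apply_apply_Polarization] at this
    simpa [rootForm_comm] using this.symm
  have h0 := (rootForm_self_pos (P := P) i).ne'
  rw [reflect, h2, P.reflection_apply, mul_div_cancel_left₀ _ h0]

lemma rootForm_root_add {i j k : ι} (h : P.root k = P.root i + P.root j) :
    P.RootForm (P.root k) (P.root k) = P.RootForm (P.root i) (P.root i)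
      + 2 * P.RootForm (P.root i) (P.root j) + P.RootForm (P.root j) (P.root j) := by
  rw [h]
  simp only [map_add, LinearMap.add_apply]
  rw [rootForm_comm (P.root j) (P.root i)]
  ring

lemma rootForm_reflectionPerm (i j : ι) :
    P.RootForm (P.root (P.reflectionPerm i j)) (P.root (P.reflectionPerm i j)) =
      P.RootForm (P.root j) (P.root j) := by
  simp only [P.root_reflectionPerm, P.rootForm_reflection_reflection_apply]

lemma isLong_reflectionPerm {i j : ι} : IsLong P (P.reflectionPerm i j) ↔ IsLong P j := by
  simp [IsLong]

lemma isShort_reflectionPerm {i j : ι} : IsShort P (P.reflectionPerm i j) ↔ IsShort P j := by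
  simp [IsShort]

omit [Fintype ι] in
lemma root_reflectionPerm_self (i : ι) : P.root (P.reflectionPerm i i) = -P.root i := by
  rw [P.root_reflectionPerm, P.reflection_apply_self]

lemma IsShort.rootForm_eq {i j : ι} (hi : IsShort P i) (hj : IsShort P j) :
    P.RootForm (P.root i) (P.root i) = P.RootForm (P.root j) (P.root j) :=
  le_antisymm (hi j) (hj i)

lemma IsLong.rootForm_eq {i j : ι} (hi : IsLong P i) (hj : IsLong P j) :
    P.RootForm (P.root i) (P.root i) = P.RootForm (P.root j) (P.root j) :=
  le_antisymm (hj i) (hi j)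

lemma IsTwist.not_isLong (hm : IsTwist P m) {i : ι} (hi : IsShort P i) : ¬ IsLong P i := by
  intro h
  have h1 := hm.2 i i h hi
  have h2 : (1 : ℝ) < m := by exact_mod_cast hm.1
  nlinarith [rootForm_self_pos (P := P) i]

variable [P.IsCrystallographic]

lemma two_mul_rootForm (i j : ι) :
    2 * P.RootForm (P.root i) (P.root j) =
      P.pairingIn ℤ i j * P.RootForm (P.root j) (P.root j) := by
  have h : (P.pairingIn ℤ i j : ℝ) = P.pairing i j := by
    simpa using P.algebraMap_pairingIn ℤ i j
  rw [h]
  exact P.toInvariantForm.two_mul_apply_root_root i j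

lemma rootForm_eq_zero_iff (i j : ι) :
    P.RootForm (P.root i) (P.root j) = 0 ↔ P.pairingIn ℤ i j = 0 := by
  have h := two_mul_rootForm (P := P) i j
  have h0 := (rootForm_self_pos (P := P) j).ne'
  constructor
  · intro h1
    rw [h1, mul_zero, eq_comm, mul_eq_zero] at h
    exact_mod_cast h.resolve_right h0
  · intro h1
    simpa [h1] using h

lemma pairingIn_eq_zero_symm {i j : ι} (h : P.pairingIn ℤ i j = 0) : P.pairingIn ℤ j i = 0 := by
  rwa [← rootForm_eq_zero_iff, rootForm_comm, rootForm_eq_zero_iff]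

omit [Fintype ι] in
lemma root_reflectionPerm_int (i j : ι) :
    P.root (P.reflectionPerm i j) = P.root j - P.pairingIn ℤ j i • P.root i := by
  rw [P.root_reflectionPerm, P.reflection_apply_root' ℤ]

omit [Fintype ι] in
lemma pairingIn_add {i j k l : ι} (h : P.root k = P.root i + P.root j) :
    P.pairingIn ℤ k l = P.pairingIn ℤ i l + P.pairingIn ℤ j l :=
  P.pairingIn_eq_add_of_root_eq_add h

lemma IsTwist.pairingIn_long_short (hm : IsTwist P m) {i j : ι} (hi : IsLong P i)
    (hj : IsShort P j) : P.pairingIn ℤ i j = m * P.pairingIn ℤ j i := by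
  have h1 := two_mul_rootForm (P := P) i j
  have h2 := two_mul_rootForm (P := P) j i
  rw [rootForm_comm, h1, hm.2 i j hi hj, ← mul_assoc] at h2
  have := mul_right_cancel₀ (rootForm_self_pos (P := P) j).ne' h2
  rw [mul_comm]
  exact_mod_cast this

/-- Two roots of equal length pair to `±1` unless they are orthogonal or proportional. -/
lemma pairingIn_of_rootForm_eq {i j : ι}
    (h : P.RootForm (P.root i) (P.root i) = P.RootForm (P.root j) (P.root j)) :
    (P.pairingIn ℤ i j = 0 ∨ (P.pairingIn ℤ i j = 1 ∧ P.pairingIn ℤ j i = 1) ∨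
      (P.pairingIn ℤ i j = -1 ∧ P.pairingIn ℤ j i = -1) ∨ i = j ∨
      P.reflectionPerm i i = j) := by
  by_cases h1 : i = j
  · simp [h1]
  by_cases h2 : P.root i = -P.root j
  · have : P.reflectionPerm i i = j := by
      apply P.root.injective
      rw [root_reflectionPerm_self, h2, neg_neg]
    simp [this]
  have := P.pairingIn_pairingIn_mem_set_of_length_eq_of_ne (B := P.toInvariantForm) h h1 h2
  simp only [Set.mem_insert_iff, Set.mem_singleton_iff, Prod.mk.injEq] at this
  tauto

variable [P.IsReduced]

/-- A long and a short root that are not orthogonal pair to `±m` and `±1`. -/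
lemma IsTwist.pairingIn_short_long (hm : IsTwist P m) {i j : ι} (hi : IsLong P i)
    (hj : IsShort P j) (h : P.pairingIn ℤ j i ≠ 0) :
    (P.pairingIn ℤ j i = 1 ∨ P.pairingIn ℤ j i = -1) ∧ (m = 2 ∨ m = 3) := by
  have h1 := hm.pairingIn_long_short hi hj
  have h2 := P.pairingIn_pairingIn_mem_set_of_isCrystal_of_isRed i j
  have h3 := hm.1
  simp only [Set.mem_insert_iff, Set.mem_singleton_iff, Prod.mk.injEq] at h2
  rcases h2 with h2 | h2 | h2 | h2 | h2 | h2 | h2 | h2 | h2 | h2 | h2 | h2 | h2 <;>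
    rw [h2.1, h2.2] at h1 <;> omega

/-- The sum of a long and a short root at an obtuse angle is a short root. -/
lemma IsTwist.exists_long_add_short (hm : IsTwist P m) {i j : ι} (hi : IsLong P i)
    (hj : IsShort P j) (h : P.pairingIn ℤ j i < 0) :
    ∃ k, IsShort P k ∧ P.root k = P.root i + P.root j := by
  have h0 := (hm.pairingIn_short_long hi hj h.ne).1
  have h1 : P.pairingIn ℤ j i = -1 := by omega
  have h2 : P.pairingIn ℤ i j < 0 := by
    rw [hm.pairingIn_long_short hi hj, h1]
    have := hm.1
    omega
  obtain ⟨k, hk⟩ := P.root_add_root_mem_of_pairingIn_neg h2 (by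
    intro h3
    have h4 := hm.2 i j hi hj
    have h5 : (1 : ℝ) < m := by exact_mod_cast hm.1
    simp only [h3, map_neg, LinearMap.neg_apply, neg_neg] at h4
    nlinarith [rootForm_self_pos (P := P) j])
  refine ⟨k, fun l => ?_, hk⟩
  have h3 := rootForm_root_add hk
  rw [two_mul_rootForm, hm.pairingIn_long_short hi hj, h1, hm.2 i j hi hj] at h3
  push_cast at h3
  linarith [hj l]

variable [P.IsIrreducible]

lemma isShort_or_isLong (i : ι) : IsShort P i ∨ IsLong P i := by
  by_contra! h
  obtain ⟨h1, h2⟩ := h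
  simp only [IsShort, IsLong, not_forall, not_le] at h1 h2
  obtain ⟨j, hj⟩ := h1
  obtain ⟨k, hk⟩ := h2
  rcases P.toInvariantForm.apply_eq_or_of_apply_ne (i := i) (j := j) hj.ne' k with h | h
  · exact hk.ne' h
  · exact (hj.trans hk).ne' h

/-- If the sum of two orthogonal roots is a root, it is long and both summands are short. -/
lemma isLong_of_add_orthogonal {i j k : ι}
    (h : P.root k = P.root i + P.root j) (h0 : P.pairingIn ℤ i j = 0) :
    IsLong P k ∧ IsShort P i ∧ IsShort P j := by
  have h1 := rootForm_root_add h
  rw [(rootForm_eq_zero_iff i j).2 h0] at h1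
  have hi := rootForm_self_pos (P := P) i
  have hj := rootForm_self_pos (P := P) j
  refine ⟨(isShort_or_isLong k).resolve_left fun hk => ?_,
    (isShort_or_isLong i).resolve_right fun hk => ?_,
    (isShort_or_isLong j).resolve_right fun hk => ?_⟩
  · linarith [hk i]
  · linarith [hk k]
  · linarith [hk k]

/-- The sum of two long roots is long, if it is a root. -/
lemma IsTwist.isLong_add (hm : IsTwist P m) {i j k : ι} (hi : IsLong P i) (hj : IsLong P j)
    (h : P.root k = P.root i + P.root j) : IsLong P k := by
  refine (isShort_or_isLong k).resolve_left fun hk => ?_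
  have h1 := rootForm_root_add h
  rw [two_mul_rootForm, hi.rootForm_eq hj, hm.2 j k hj hk] at h1
  have h2 : P.RootForm (P.root k) (P.root k) * 1 = P.RootForm (P.root k) (P.root k) *
      (m * (2 + P.pairingIn ℤ i j)) := by linarith
  have h3 := mul_left_cancel₀ (rootForm_self_pos (P := P) k).ne' h2
  have h4 : (1 : ℤ) = m * (2 + P.pairingIn ℤ i j) := by exact_mod_cast h3
  have h5 := Int.isUnit_iff.1 (IsUnit.of_mul_eq_one _ h4.symm)
  have h6 := hm.1
  omega

omit [P.IsReduced] in
/-- Roots of equal length are conjugate: a property of roots that is stable under all reflections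
and holds for one root holds for every root of the same length. -/
lemma of_rootForm_eq {Q : ι → Prop} (hQ : ∀ i j, Q j → Q (P.reflectionPerm i j)) {i j : ι}
    (hi : Q i) (h : P.RootForm (P.root i) (P.root i) = P.RootForm (P.root j) (P.root j)) :
    Q j := by
  by_contra hj
  set s : Set ι := {l | Q l ∧ P.RootForm (P.root l) (P.root l) = P.RootForm (P.root j) (P.root j)}
    with hs
  have hsj : ∀ l ∈ s, P.pairingIn ℤ l j = 0 := by
    rintro l ⟨hl, hlj⟩
    -- If `l` and `j` are not orthogonal, a few reflections in `l` and `j` take `l` to `j`.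
    rcases pairingIn_of_rootForm_eq hlj with h0 | ⟨h1, h2⟩ | ⟨h1, h2⟩ | rfl | rfl
    · exact h0
    · refine absurd ?_ hj
      convert hQ l _ (hQ (P.reflectionPerm j l) _ (hQ j l hl))
      apply P.root.injective
      rw [P.root_reflectionPerm, root_reflectionPerm_self, root_reflectionPerm_int, h1, neg_sub,
        one_smul, map_sub, P.reflection_apply_self, P.reflection_apply_root' ℤ, h2]
      module
    · refine absurd ?_ hj
      convert hQ l _ (hQ j l hl)
      apply P.root.injective
      rw [P.root_reflectionPerm, root_reflectionPerm_int, h1, map_sub, map_zsmul,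
        P.reflection_apply_self, P.reflection_apply_root' ℤ, h2]
      module
    · exact absurd hl hj
    · exact absurd (hQ l l hl) hj
  have htop : Submodule.span ℝ (P.root '' s) = ⊤ := by
    refine P.span_root_image_eq_top_of_forall_orthogonal s ⟨i, hi, h⟩ fun k hk l hl => ?_
    by_contra hkl
    apply hk
    have hlk : P.pairing l k ≠ 0 := fun h0 => hkl (P.isOrthogonal_symm k l |>.2
      (P.isOrthogonal_iff_pairing_eq_zero.2 h0))
    have h1 : P.root (P.reflectionPerm k l) ∈ Submodule.span ℝ (P.root '' s) :=
      Submodule.subset_span ⟨_, ⟨hQ k l hl.1, (rootForm_reflectionPerm k l).trans hl.2⟩, rfl⟩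
    have h2 : P.root l ∈ Submodule.span ℝ (P.root '' s) := Submodule.subset_span ⟨l, hl, rfl⟩
    rw [P.root_reflectionPerm, P.reflection_apply_root] at h1
    exact (Submodule.smul_mem_iff _ hlk).1 ((Submodule.sub_mem_iff_right _ h2).1 h1)
  have hle : Submodule.span ℝ (P.root '' s) ≤ LinearMap.ker (P.RootForm (P.root j)) := by
    rw [Submodule.span_le]
    rintro _ ⟨l, hl, rfl⟩
    rw [SetLike.mem_coe, LinearMap.mem_ker, rootForm_comm, rootForm_eq_zero_iff]
    exact hsj l hl
  rw [htop, top_le_iff] at hle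
  have : P.root j ∈ LinearMap.ker (P.RootForm (P.root j)) := hle ▸ Submodule.mem_top
  exact (rootForm_self_pos (P := P) j).ne' this

variable [P.IsRootSystem]

omit [Fintype ι] in
lemma nonempty_index (P : RootPairing ι ℝ V N) [P.IsRootSystem] [P.IsIrreducible] : Nonempty ι := by
  by_contra h
  rw [not_nonempty_iff] at h
  have h1 := RootPairing.IsRootSystem.span_root_eq_top (P := P)
  have := RootPairing.IsIrreducible.nontrivial P
  simp [Set.range_eq_empty] at h1

variable (P) in
omit [P.IsCrystallographic] [P.IsReduced] in
lemma exists_isShort : ∃ i, IsShort P i := by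
  have := nonempty_index P
  exact Finite.exists_min fun i => P.RootForm (P.root i) (P.root i)

variable (P) in
omit [P.IsCrystallographic] [P.IsReduced] in
lemma exists_isLong : ∃ i, IsLong P i := by
  have := nonempty_index P
  exact Finite.exists_max fun i => P.RootForm (P.root i) (P.root i)

/-- There is a long root that is the sum of two short ones, with all pairings known. -/
lemma IsTwist.exists_short_add_short (hm : IsTwist P m) : (m = 2 ∨ m = 3) ∧
    ∃ i j k, IsShort P i ∧ IsShort P j ∧ IsLong P k ∧ P.root k = P.root i + P.root j ∧
      P.pairingIn ℤ i k = 1 ∧ P.pairingIn ℤ j i = m - 2 := by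
  obtain ⟨i, hi⟩ := exists_isShort P
  obtain ⟨l, hl⟩ := exists_isLong P
  obtain ⟨k', hk', hik'⟩ := P.exists_form_eq_form_and_form_ne_zero P.toInvariantForm i l
  have hk'l : IsLong P k' := fun j => (hl j).trans_eq hk'.symm
  have hik0 : P.pairingIn ℤ i k' ≠ 0 := by
    rwa [Ne, ← rootForm_eq_zero_iff]
  obtain ⟨k, hk, hik⟩ : ∃ k, IsLong P k ∧ P.pairingIn ℤ i k = 1 := by
    rcases (hm.pairingIn_short_long hk'l hi hik0).1 with h | h
    · exact ⟨k', hk'l, h⟩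
    · exact ⟨P.reflectionPerm k' k', isLong_reflectionPerm.2 hk'l, by simp [h]⟩
  obtain ⟨j, hj, hjk⟩ := hm.exists_long_add_short hk (isShort_reflectionPerm (i := i).2 hi)
    (by simp [hik])
  have hkij : P.root k = P.root i + P.root j := by
    rw [hjk, root_reflectionPerm_self]
    abel
  refine ⟨(hm.pairingIn_short_long hk hi (by omega)).2, i, j, k, hi, hj, hk, hkij, hik, ?_⟩
  have := pairingIn_add (l := i) hkij
  rw [hm.pairingIn_long_short hk hi, hik, P.pairingIn_same] at this
  linarith

end Lengths

/-! ### Subroot systems as families of integers -/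

/-- The set of all `α + k δ` with `α = P.root i` and `k ∈ Z i`. -/
def ofLevel (P : RootPairing ι ℝ V N) (Z : ι → Set ℤ) : Set (V × ℝ) :=
  {x | ∃ i, ∃ k ∈ Z i, x = (P.root i, (k : ℝ))}

/-- The family of integers describing the full set of real roots. -/
def realLevel (P : RootPairing ι ℝ V N) (m : ℕ) (i : ι) : Set ℤ :=
  {k | IsLong P i → (m : ℤ) ∣ k}

/-- The condition on a family of sets of integers, one for each finite root, that it describes a
closed subroot system of the affine root system. -/
structure IsClosedLevel (P : RootPairing ι ℝ V N) [P.IsCrystallographic] (m : ℕ)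
    (Z : ι → Set ℤ) : Prop where
  nonempty : ∃ i, (Z i).Nonempty
  le : Z ≤ realLevel P m
  refl_mem : ∀ i j, ∀ a ∈ Z i, ∀ b ∈ Z j, b - P.pairingIn ℤ j i * a ∈ Z (P.reflectionPerm i j)
  add_mem : ∀ i j k, P.root k = P.root i + P.root j → ∀ a ∈ Z i, ∀ b ∈ Z j,
    a + b ∈ realLevel P m k → a + b ∈ Z k

/-- The condition on a set of indices that it describes a closed subroot system of the finite root
system. -/
structure IsClosedIndex (P : RootPairing ι ℝ V N) (I : Set ι) : Prop where
  nonempty : I.Nonempty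
  refl_mem : ∀ i ∈ I, ∀ j ∈ I, P.reflectionPerm i j ∈ I
  add_mem : ∀ i ∈ I, ∀ j ∈ I, ∀ k, P.root k = P.root i + P.root j → k ∈ I

omit [Fintype ι] in
lemma mk_mem_ofLevel {Z : ι → Set ℤ} {i : ι} {k : ℤ} :
    ((P.root i, (k : ℝ)) : V × ℝ) ∈ ofLevel P Z ↔ k ∈ Z i := by
  constructor
  · rintro ⟨j, l, hl, h⟩
    simp only [Prod.mk.injEq, EmbeddingLike.apply_eq_iff_eq, Int.cast_inj] at h
    rw [h.1, h.2]
    exact hl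
  · exact fun h => ⟨i, k, h, rfl⟩

omit [Fintype ι] in
lemma ofLevel_subset_iff {Y Z : ι → Set ℤ} : ofLevel P Y ⊆ ofLevel P Z ↔ Y ≤ Z := by
  constructor
  · exact fun h i k hk => mk_mem_ofLevel.1 (h (mk_mem_ofLevel.2 hk))
  · rintro h _ ⟨i, k, hk, rfl⟩
    exact ⟨i, k, h i hk, rfl⟩

omit [Fintype ι] in
lemma ofLevel_injective : Function.Injective (ofLevel P) := fun _ _ h =>
  le_antisymm (ofLevel_subset_iff.1 h.subset) (ofLevel_subset_iff.1 h.superset)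

omit [Fintype ι] in
lemma gradient_ofLevel (Z : ι → Set ℤ) :
    gradient (ofLevel P Z) = P.root '' {i | (Z i).Nonempty} := by
  ext v
  constructor
  · rintro ⟨_, ⟨i, k, hk, rfl⟩, rfl⟩
    exact ⟨i, ⟨k, hk⟩, rfl⟩
  · rintro ⟨i, ⟨k, hk⟩, rfl⟩
    exact ⟨_, ⟨i, k, hk, rfl⟩, rfl⟩

omit [Fintype ι] in
lemma image_root_eq_finiteRoots_iff {I : Set ι} :
    P.root '' I = finiteRoots P ↔ I = Set.univ := by
  rw [finiteRoots, ← Set.image_univ]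
  exact P.root.injective.image_injective.eq_iff

section Irreducible

variable [P.IsCrystallographic] [P.IsReduced] [P.IsIrreducible]

lemma IsTwist.realRoots_eq (hm : IsTwist P m) : realRoots P m = ofLevel P (realLevel P m) := by
  ext x
  constructor
  · rintro (⟨i, r, hi, rfl⟩ | ⟨i, r, hi, rfl⟩)
    · exact ⟨i, r, fun h => absurd h (hm.not_isLong hi), rfl⟩
    · exact ⟨i, m * r, fun _ => dvd_mul_right _ _, by simp⟩
  · rintro ⟨i, k, hk, rfl⟩
    rcases isShort_or_isLong (P := P) i with hi | hi
    · exact Or.inl ⟨i, k, hi, rfl⟩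
    · obtain ⟨r, rfl⟩ := hk hi
      exact Or.inr ⟨i, r, hi, by simp⟩

lemma IsTwist.exists_ofLevel (hm : IsTwist P m) {Ψ : Set (V × ℝ)} (h : Ψ ⊆ realRoots P m) :
    ∃ Z, Ψ = ofLevel P Z := by
  refine ⟨fun i => {k | (P.root i, (k : ℝ)) ∈ Ψ}, Set.Subset.antisymm (fun x hx => ?_) ?_⟩
  · have := h hx
    rw [hm.realRoots_eq] at this
    obtain ⟨i, k, -, rfl⟩ := this
    exact ⟨i, k, hx, rfl⟩
  · rintro _ ⟨i, k, hk, rfl⟩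
    exact hk

omit [P.IsReduced] [P.IsIrreducible] in
lemma reflect_affineForm (i j : ι) (a b : ℤ) :
    reflect (affineForm P) (P.root i, (a : ℝ)) (P.root j, (b : ℝ)) =
      (P.root (P.reflectionPerm i j), ((b - P.pairingIn ℤ j i * a : ℤ) : ℝ)) := by
  have h : 2 * P.RootForm (P.root j) (P.root i) / P.RootForm (P.root i) (P.root i) =
      P.pairingIn ℤ j i := by
    rw [two_mul_rootForm, mul_div_cancel_right₀ _ (rootForm_self_pos i).ne']
  ext
  · simp only [root_reflectionPerm_int]
    simp [reflect, affineForm, h, Int.cast_smul_eq_zsmul]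
  · simp [reflect, affineForm, h]

lemma IsTwist.isClosedSubrootSystem_ofLevel_iff (hm : IsTwist P m) {Z : ι → Set ℤ} :
    IsClosedSubrootSystem (affineForm P) (realRoots P m) (ofLevel P Z) ↔
      IsClosedLevel P m Z := by
  rw [hm.realRoots_eq]
  constructor
  · rintro ⟨⟨⟨_, i, k, hk, -⟩, hsub, hrefl⟩, hadd⟩
    refine ⟨⟨i, k, hk⟩, ofLevel_subset_iff.1 hsub, fun i j a ha b hb => ?_,
      fun i j k h a ha b hb hab => ?_⟩
    · have := hrefl _ (mk_mem_ofLevel.2 ha) _ (mk_mem_ofLevel.2 hb)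
      rwa [reflect_affineForm, mk_mem_ofLevel] at this
    · have := hadd _ (mk_mem_ofLevel.2 ha) _ (mk_mem_ofLevel.2 hb)
      rw [Prod.mk_add_mk, ← h, ← Int.cast_add, mk_mem_ofLevel, mk_mem_ofLevel] at this
      exact this hab
  · intro h
    refine ⟨⟨?_, ofLevel_subset_iff.2 h.le, ?_⟩, ?_⟩
    · obtain ⟨i, k, hk⟩ := h.nonempty
      exact ⟨_, i, k, hk, rfl⟩
    · rintro _ ⟨i, a, ha, rfl⟩ _ ⟨j, b, hb, rfl⟩
      rw [reflect_affineForm, mk_mem_ofLevel]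
      exact h.refl_mem i j a ha b hb
    · rintro _ ⟨i, a, ha, rfl⟩ _ ⟨j, b, hb, rfl⟩ ⟨k, c, hc, hk⟩
      simp only [Prod.mk_add_mk, Prod.mk.injEq] at hk
      obtain ⟨hk1, hk2⟩ := hk
      have hc' : a + b = c := by exact_mod_cast hk2
      exact ⟨k, a + b, h.add_mem i j k hk1.symm a ha b hb (hc' ▸ hc), by simp [hk1]⟩

lemma IsTwist.isMaximalClosed_ofLevel_iff (hm : IsTwist P m) {Z : ι → Set ℤ} :
    IsMaximalClosed (affineForm P) (realRoots P m) (ofLevel P Z) ↔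
      IsClosedLevel P m Z ∧ Z ≠ realLevel P m ∧
        ∀ Y, IsClosedLevel P m Y → Z ≤ Y → Y ≠ realLevel P m → Y = Z := by
  rw [IsMaximalClosed, hm.isClosedSubrootSystem_ofLevel_iff]
  refine and_congr_right fun _ => and_congr ?_ ⟨fun h Y hY hZY hne => ?_, fun h D hD hZD hne => ?_⟩
  · rw [hm.realRoots_eq, ofLevel_injective.ne_iff]
  · refine ofLevel_injective (h _ (hm.isClosedSubrootSystem_ofLevel_iff.2 hY)
      (ofLevel_subset_iff.2 hZY) ?_)
    rwa [hm.realRoots_eq, ofLevel_injective.ne_iff]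
  · obtain ⟨Y, rfl⟩ := hm.exists_ofLevel hD.1.subset
    rw [hm.realRoots_eq, ofLevel_injective.ne_iff] at hne
    rw [h Y (hm.isClosedSubrootSystem_ofLevel_iff.1 hD) (ofLevel_subset_iff.1 hZD) hne]

omit [P.IsCrystallographic] [P.IsReduced] [P.IsIrreducible] in
lemma isClosedSubrootSystem_image_iff {I : Set ι} :
    IsClosedSubrootSystem P.RootForm (finiteRoots P) (P.root '' I) ↔ IsClosedIndex P I := by
  have hmem : ∀ {i}, P.root i ∈ P.root '' I ↔ i ∈ I := P.root.injective.mem_set_image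
  constructor
  · rintro ⟨⟨hne, -, hrefl⟩, hadd⟩
    refine ⟨Set.image_nonempty.1 hne, fun i hi j hj => ?_, fun i hi j hj k h => ?_⟩
    · have := hrefl _ (hmem.2 hi) _ (hmem.2 hj)
      rwa [reflect_rootForm, ← P.root_reflectionPerm, hmem] at this
    · have := hadd _ (hmem.2 hi) _ (hmem.2 hj)
      rw [← h, hmem] at this
      exact this ⟨k, rfl⟩
  · rintro ⟨hne, hrefl, hadd⟩
    refine ⟨⟨hne.image _, Set.image_subset_range _ _, ?_⟩, ?_⟩
    · rintro _ ⟨i, hi, rfl⟩ _ ⟨j, hj, rfl⟩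
      rw [reflect_rootForm, ← P.root_reflectionPerm, hmem]
      exact hrefl i hi j hj
    · rintro _ ⟨i, hi, rfl⟩ _ ⟨j, hj, rfl⟩ ⟨k, hk⟩
      rw [← hk, hmem]
      exact hadd i hi j hj k hk

omit [P.IsCrystallographic] [P.IsReduced] [P.IsIrreducible] in
lemma isMaximalClosed_image_iff {I : Set ι} :
    IsMaximalClosed P.RootForm (finiteRoots P) (P.root '' I) ↔
      IsClosedIndex P I ∧ I ≠ Set.univ ∧
        ∀ J, IsClosedIndex P J → I ⊆ J → J ≠ Set.univ → J = I := by
  have hinj := P.root.injective.image_injective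
  rw [IsMaximalClosed, isClosedSubrootSystem_image_iff, Ne, image_root_eq_finiteRoots_iff]
  refine and_congr_right fun _ => and_congr Iff.rfl ⟨fun h J hJ hIJ hne => ?_,
    fun h D hD hID hne => ?_⟩
  · exact hinj (h _ (isClosedSubrootSystem_image_iff.2 hJ) (Set.image_mono hIJ)
      (image_root_eq_finiteRoots_iff.not.2 hne))
  · obtain ⟨J, rfl⟩ := Set.subset_range_iff_exists_image_eq.1 hD.1.subset
    rw [h J (isClosedSubrootSystem_image_iff.1 hD) ((Set.image_subset_image_iff
      P.root.injective).1 hID) (image_root_eq_finiteRoots_iff.not.1 hne)]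

end Irreducible

/-! ### Gradients that are not everything -/

/-- The family of integers describing the lift of a set of finite roots. -/
def liftLevel (P : RootPairing ι ℝ V N) (m : ℕ) (I : Set ι) (i : ι) : Set ℤ :=
  {k | i ∈ I ∧ k ∈ realLevel P m i}

lemma zero_mem_realLevel (i : ι) : (0 : ℤ) ∈ realLevel P m i := fun _ => dvd_zero _

section Lift

lemma liftLevel_nonempty_iff {I : Set ι} {i : ι} : (liftLevel P m I i).Nonempty ↔ i ∈ I :=
  ⟨fun ⟨_, h⟩ => h.1, fun h => ⟨0, h, zero_mem_realLevel i⟩⟩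

lemma liftLevel_mono {I J : Set ι} (h : I ⊆ J) : liftLevel P m I ≤ liftLevel P m J :=
  fun _ _ hk => ⟨h hk.1, hk.2⟩

lemma liftLevel_ne_realLevel {I : Set ι} (hI : I ≠ Set.univ) :
    liftLevel P m I ≠ realLevel P m := by
  intro h
  refine hI (Set.eq_univ_of_forall fun i => ?_)
  have : (0 : ℤ) ∈ liftLevel P m I i := h ▸ zero_mem_realLevel i
  exact this.1

lemma liftLevel_injective : Function.Injective (liftLevel P m) := by
  intro I J h
  ext i
  rw [← liftLevel_nonempty_iff (P := P) (m := m), h, liftLevel_nonempty_iff]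

variable [P.IsCrystallographic]

/-- The real roots are stable under reflections: long roots pair with short ones to multiples of
`m`. -/
lemma sub_mem_realLevel_reflectionPerm (hm : IsTwist P m) [P.IsReduced] [P.IsIrreducible]
    {i j : ι} {a b : ℤ} (ha : a ∈ realLevel P m i) (hb : b ∈ realLevel P m j) :
    b - P.pairingIn ℤ j i * a ∈ realLevel P m (P.reflectionPerm i j) := by
  intro h
  rw [isLong_reflectionPerm] at h
  refine dvd_sub (hb h) ?_
  rcases isShort_or_isLong (P := P) i with hi | hi
  · rw [hm.pairingIn_long_short h hi, mul_assoc]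
    exact dvd_mul_right _ _
  · exact (ha hi).mul_left _

variable [P.IsReduced] [P.IsIrreducible]

lemma IsTwist.lift_eq (hm : IsTwist P m) (I : Set ι) :
    lift P m (P.root '' I) = ofLevel P (liftLevel P m I) := by
  ext x
  rw [lift, hm.realRoots_eq]
  constructor
  · rintro ⟨⟨i, k, hk, rfl⟩, h⟩
    exact ⟨i, k, ⟨P.root.injective.mem_set_image.1 h, hk⟩, rfl⟩
  · rintro ⟨i, k, ⟨hi, hk⟩, rfl⟩
    exact ⟨⟨i, k, hk, rfl⟩, Set.mem_image_of_mem _ hi⟩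

lemma IsClosedIndex.isClosedLevel_lift (hm : IsTwist P m) {I : Set ι} (hI : IsClosedIndex P I) :
    IsClosedLevel P m (liftLevel P m I) where
  nonempty := hI.nonempty.imp fun _ hi => liftLevel_nonempty_iff.2 hi
  le _ _ hk := hk.2
  refl_mem i j _ ha _ hb :=
    ⟨hI.refl_mem i ha.1 j hb.1, sub_mem_realLevel_reflectionPerm hm ha.2 hb.2⟩
  add_mem i j k h _ ha _ hb hab := ⟨hI.add_mem i ha.1 j hb.1 k h, hab⟩

omit [P.IsReduced] in
/-- The closed subroot system of all `α + k δ` with `m ∣ k`. -/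
lemma isClosedLevel_dvd [P.IsRootSystem] :
    IsClosedLevel P m fun _ => {k | (m : ℤ) ∣ k} where
  nonempty := (nonempty_index P).elim fun i => ⟨i, 0, dvd_zero _⟩
  le _ _ hk _ := hk
  refl_mem _ _ _ ha _ hb := dvd_sub hb (Dvd.dvd.mul_left ha _)
  add_mem _ _ _ _ _ ha _ hb _ := dvd_add ha hb

/-- A maximal closed subroot system whose gradient is closed and proper is the lift of its gradient,
which is maximal closed and contains a short root: the lift of a set of long roots is properly
contained in the closed subroot system of all `α + k δ` with `m ∣ k`. -/
lemma isMaximal_gradient (hm : IsTwist P m) [P.IsRootSystem] {Z : ι → Set ℤ}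
    (hZ : IsClosedLevel P m Z)
    (hmax : ∀ Y, IsClosedLevel P m Y → Z ≤ Y → Y ≠ realLevel P m → Y = Z)
    {I : Set ι} (hIZ : I = {i | (Z i).Nonempty}) (hI : IsClosedIndex P I) (hne : I ≠ Set.univ) :
    Z = liftLevel P m I ∧ (∀ J, IsClosedIndex P J → I ⊆ J → J ≠ Set.univ → J = I) ∧
      ∃ i ∈ I, IsShort P i := by
  have hle : Z ≤ liftLevel P m I := fun i k hk => ⟨by rw [hIZ]; exact ⟨k, hk⟩, hZ.le i hk⟩
  have hlift : ∀ J, IsClosedIndex P J → I ⊆ J → J ≠ Set.univ → liftLevel P m J = Z :=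
    fun J hJ hIJ hJne => hmax _ (hJ.isClosedLevel_lift hm) (hle.trans (liftLevel_mono hIJ))
      (liftLevel_ne_realLevel hJne)
  have hZI := hlift I hI subset_rfl hne
  refine ⟨hZI.symm, fun J hJ hIJ hJne => liftLevel_injective ((hlift J hJ hIJ hJne).trans
    hZI.symm), ?_⟩
  by_contra! hshort
  obtain ⟨i, hi⟩ := exists_isShort P
  have h1 : (fun _ => {k | (m : ℤ) ∣ k}) = Z := by
    refine hmax _ isClosedLevel_dvd (fun j k hk => ?_) fun h => ?_
    · obtain ⟨hj, hk⟩ := hle j hk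
      exact hk ((isShort_or_isLong (P := P) j).resolve_left (hshort j hj))
    · have : (1 : ℤ) ∈ realLevel P m i := fun h => absurd h (hm.not_isLong hi)
      rw [← h] at this
      have h2 := Int.eq_one_of_dvd_one (by positivity) this
      have h3 := hm.1
      omega
  have h2 : (0 : ℤ) ∈ Z i := by
    rw [← h1]
    exact dvd_zero _
  exact hshort i (hle i h2).1 hi

end Lift

/-! ### Lifts of maximal closed subroot systems -/

section MaximalLift

omit [Fintype ι] in
lemma IsClosedIndex.neg_mem {I : Set ι} (hI : IsClosedIndex P I) {i : ι} (hi : i ∈ I) :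
    P.reflectionPerm i i ∈ I := hI.refl_mem i hi i hi

variable [P.IsCrystallographic]

/-- The indices of the roots strongly orthogonal to all roots with index in `A`: those `j` such
that `P.root j` is orthogonal to `P.root i` and `P.root j + P.root i` is not a root, for all
`i ∈ A`. -/
def strongOrthogonal (P : RootPairing ι ℝ V N) [P.IsCrystallographic] (A : Set ι) : Set ι :=
  {j | ∀ i ∈ A, P.pairingIn ℤ j i = 0 ∧ ∀ k, P.root k ≠ P.root j + P.root i}

lemma reflectionPerm_mem_strongOrthogonal {A : Set ι} {i j : ι} (hi : i ∈ strongOrthogonal P A)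
    (hj : j ∈ strongOrthogonal P A) : P.reflectionPerm i j ∈ strongOrthogonal P A := by
  intro l hl
  have hli : P.pairingIn ℤ l i = 0 := pairingIn_eq_zero_symm (hi l hl).1
  have hfix : P.reflectionPerm i l = l := by
    apply P.root.injective
    rw [root_reflectionPerm_int, hli, zero_smul, sub_zero]
  constructor
  · have := P.pairingIn_reflectionPerm ℤ i j l
    rw [← this, hfix]
    exact (hj l hl).1
  · intro k hk
    apply (hj l hl).2 (P.reflectionPerm i k)
    rw [P.root_reflectionPerm, hk, map_add, ← P.root_reflectionPerm, ← P.root_reflectionPerm,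
      P.reflectionPerm_self, hfix]

lemma add_mem_strongOrthogonal {A : Set ι} {i j k : ι} (hi : i ∈ strongOrthogonal P A)
    (hj : j ∈ strongOrthogonal P A) (h : P.root k = P.root i + P.root j) :
    k ∈ strongOrthogonal P A := by
  intro l hl
  have hkl : P.pairingIn ℤ k l = 0 := by rw [pairingIn_add h, (hi l hl).1, (hj l hl).1, add_zero]
  refine ⟨hkl, fun t ht => ?_⟩
  -- One of `i`, `j` makes an acute angle with `i + j`, hence with `t = i + j + l`; subtracting it
  -- from `t` leaves a root, which is the other one plus `l`.
  have key : ∀ i j, i ∈ strongOrthogonal P A → j ∈ strongOrthogonal P A →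
      P.root k = P.root i + P.root j → P.pairingIn ℤ k i ≤ 0 := by
    intro i j hi hj h
    by_contra! hpos
    have hti : 0 < P.pairingIn ℤ t i := by
      rw [pairingIn_add ht, pairingIn_eq_zero_symm (hi l hl).1, add_zero]
      exact hpos
    have hne : t ≠ i := by
      rintro rfl
      have h0 : P.root j + P.root l = 0 := by
        rw [h, add_assoc] at ht
        simpa using ht
      have := pairingIn_eq_zero_symm (hj l hl).1
      have h1 := two_mul_rootForm (P := P) l j
      rw [this, eq_neg_of_add_eq_zero_right h0] at h1
      have := rootForm_self_pos (P := P) j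
      simp at h1
      exact this.ne' h1
    obtain ⟨s, hs⟩ := P.root_sub_root_mem_of_pairingIn_pos hti hne
    refine (hj l hl).2 s ?_
    rw [hs, ht, h]
    abel
  have h1 := key i j hi hj h
  have h2 := key j i hj hi (by rw [h, add_comm])
  have h3 : 2 * P.RootForm (P.root k) (P.root k) =
      P.pairingIn ℤ k i * P.RootForm (P.root i) (P.root i) +
      P.pairingIn ℤ k j * P.RootForm (P.root j) (P.root j) := by
    rw [← two_mul_rootForm, ← two_mul_rootForm, ← mul_add, ← map_add, ← h]
  have h4 : (P.pairingIn ℤ k i : ℝ) ≤ 0 := by exact_mod_cast h1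
  have h5 : (P.pairingIn ℤ k j : ℝ) ≤ 0 := by exact_mod_cast h2
  have := mul_nonpos_of_nonpos_of_nonneg h4 (rootForm_self_pos (P := P) i).le
  have := mul_nonpos_of_nonpos_of_nonneg h5 (rootForm_self_pos (P := P) j).le
  linarith [rootForm_self_pos (P := P) k]

variable [P.IsReduced] [P.IsIrreducible]

/-- For a closed `I` with set `A` of short roots, every root of `I` that is not strongly orthogonal
to `A` lies in the span of `A`, so it is strongly orthogonal to the roots strongly orthogonal to
`A`. -/
lemma IsClosedIndex.strongOrthogonal_of_notMem (hm : IsTwist P m) {I : Set ι}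
    (hI : IsClosedIndex P I) {i j : ι} (hi : i ∈ I)
    (hi' : i ∉ strongOrthogonal P {i | i ∈ I ∧ IsShort P i})
    (hj : j ∈ strongOrthogonal P {i | i ∈ I ∧ IsShort P i}) :
    P.pairingIn ℤ j i = 0 ∧ ∀ k, P.root k ≠ P.root j + P.root i := by
  rcases isShort_or_isLong (P := P) i with hs | hl
  · exact hj i ⟨hi, hs⟩
  suffices h : P.pairingIn ℤ j i = 0 from
    ⟨h, fun k hk => hm.not_isLong (isLong_of_add_orthogonal hk h).2.2 hl⟩
  obtain ⟨c, ⟨hc, hcs⟩, hci⟩ : ∃ c ∈ {i | i ∈ I ∧ IsShort P i}, P.pairingIn ℤ i c ≠ 0 := by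
    by_contra! h
    exact hi' fun c hc => ⟨h c hc, fun k hk =>
      hm.not_isLong (isLong_of_add_orthogonal hk (h c hc)).2.1 hl⟩
  obtain ⟨d, hd, hds, hdi⟩ : ∃ d ∈ I, IsShort P d ∧ P.pairingIn ℤ d i < 0 := by
    have hci' : P.pairingIn ℤ c i ≠ 0 := fun h => hci (pairingIn_eq_zero_symm h)
    rcases lt_or_gt_of_ne hci' with h | h
    · exact ⟨c, hc, hcs, h⟩
    · exact ⟨P.reflectionPerm c c, hI.neg_mem hc, isShort_reflectionPerm.2 hcs, by simpa using h⟩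
  obtain ⟨k, hk, hkid⟩ := hm.exists_long_add_short hl hds hdi
  have h1 := (rootForm_eq_zero_iff j k).2 (hj k ⟨hI.add_mem i hi d hd k hkid, hk⟩).1
  have h2 := (rootForm_eq_zero_iff j d).2 (hj d ⟨hd, hds⟩).1
  rw [hkid, map_add, h2, add_zero] at h1
  exact (rootForm_eq_zero_iff j i).1 h1

/-- A maximal closed subset with a short root has no further root strongly orthogonal to all its
short roots: otherwise adding all of these would exhaust the root system and decompose it into two
orthogonal parts. -/
lemma strongOrthogonal_subset (hm : IsTwist P m) [P.IsRootSystem] {I : Set ι}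
    (hI : IsClosedIndex P I)
    (hmax : ∀ J, IsClosedIndex P J → I ⊆ J → J ≠ Set.univ → J = I) {c : ι} (hc : c ∈ I)
    (hcs : IsShort P c) : strongOrthogonal P {i | i ∈ I ∧ IsShort P i} ⊆ I := by
  set C := strongOrthogonal P {i | i ∈ I ∧ IsShort P i} with hC
  have horth : ∀ i ∈ I \ C, ∀ j ∈ C,
      P.pairingIn ℤ j i = 0 ∧ ∀ k, P.root k ≠ P.root j + P.root i :=
    fun i hi j hj => hI.strongOrthogonal_of_notMem hm hi.1 hi.2 hj
  have hfix : ∀ {i j}, P.pairingIn ℤ j i = 0 → P.reflectionPerm i j = j := by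
    intro i j h
    apply P.root.injective
    rw [root_reflectionPerm_int, h, zero_smul, sub_zero]
  have hclosed : IsClosedIndex P (I ∪ C) := by
    refine ⟨⟨c, Or.inl hc⟩, fun i hi j hj => ?_, fun i hi j hj k hk => ?_⟩
    · by_cases hiC : i ∈ C <;> by_cases hjC : j ∈ C
      · exact Or.inr (reflectionPerm_mem_strongOrthogonal hiC hjC)
      · have hjI := hj.resolve_right hjC
        rw [hfix (pairingIn_eq_zero_symm (horth j ⟨hjI, hjC⟩ i hiC).1)]
        exact hj
      · have hiI := hi.resolve_right hiC
        rw [hfix (horth i ⟨hiI, hiC⟩ j hjC).1]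
        exact hj
      · exact Or.inl (hI.refl_mem i (hi.resolve_right hiC) j (hj.resolve_right hjC))
    · by_cases hiC : i ∈ C <;> by_cases hjC : j ∈ C
      · exact Or.inr (add_mem_strongOrthogonal hiC hjC hk)
      · exact absurd hk ((horth j ⟨hj.resolve_right hjC, hjC⟩ i hiC).2 k)
      · rw [add_comm] at hk
        exact absurd hk ((horth i ⟨hi.resolve_right hiC, hiC⟩ j hjC).2 k)
      · exact Or.inl (hI.add_mem i (hi.resolve_right hiC) j (hj.resolve_right hjC) k hk)
  by_cases huniv : I ∪ C = Set.univ
  · have hcC : c ∉ C := fun h => by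
      have := (h c ⟨hc, hcs⟩).1
      simp at this
    suffices h : C = ∅ by simp [h]
    by_contra hne
    have htop := P.span_root_image_eq_top_of_forall_orthogonal C
      (Set.nonempty_iff_ne_empty.2 hne) fun j hj i hi => by
        have hjC : j ∉ C := fun h => hj (Submodule.subset_span ⟨j, h, rfl⟩)
        have hjI : j ∈ I := ((huniv.symm ▸ Set.mem_univ j : j ∈ I ∪ C)).resolve_right hjC
        rw [P.isOrthogonal_iff_pairing_eq_zero, ← P.algebraMap_pairingIn ℤ,
          pairingIn_eq_zero_symm (horth j ⟨hjI, hjC⟩ i hi).1, map_zero]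
    have hle : Submodule.span ℝ (P.root '' C) ≤ LinearMap.ker (P.RootForm (P.root c)) := by
      rw [Submodule.span_le]
      rintro _ ⟨l, hl, rfl⟩
      rw [SetLike.mem_coe, LinearMap.mem_ker, rootForm_comm, rootForm_eq_zero_iff]
      exact (hl c ⟨hc, hcs⟩).1
    rw [htop, top_le_iff] at hle
    have : P.root c ∈ LinearMap.ker (P.RootForm (P.root c)) := hle ▸ Submodule.mem_top
    exact (rootForm_self_pos (P := P) c).ne' this
  · rw [← hmax _ hclosed Set.subset_union_left huniv]
    exact Set.subset_union_right

/-- The roots all of whose real translates are present. -/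
def fullIndex (P : RootPairing ι ℝ V N) (m : ℕ) (Z : ι → Set ℤ) : Set ι :=
  {i | realLevel P m i ⊆ Z i}

variable {Z : ι → Set ℤ}

/-- Closedness uses that a short root is never the sum of two long ones: so the real translates of
a sum of roots are sums of real translates. -/
lemma IsClosedLevel.isClosedIndex_fullIndex (hm : IsTwist P m) (hZ : IsClosedLevel P m Z)
    (hne : (fullIndex P m Z).Nonempty) : IsClosedIndex P (fullIndex P m Z) where
  nonempty := hne
  refl_mem i hi j hj k hk := by
    have hk' : k ∈ realLevel P m j := fun h => hk (isLong_reflectionPerm.2 h)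
    simpa using hZ.refl_mem i j 0 (hi (zero_mem_realLevel i)) k (hj hk')
  add_mem i hi j hj k h c hc := by
    by_cases hcj : c ∈ realLevel P m j
    · simpa using hZ.add_mem i j k h 0 (hi (zero_mem_realLevel i)) c (hj hcj) (by simpa using hc)
    by_cases hci : c ∈ realLevel P m i
    · simpa using hZ.add_mem i j k h c (hi hci) 0 (hj (zero_mem_realLevel j)) (by simpa using hc)
    · simp only [realLevel, Set.mem_ofPred_eq, Classical.not_imp] at hcj hci
      exact absurd (hc (hm.isLong_add hci.1 hcj.1 h)) hcj.2

/-- A root that occurs and is not orthogonal to a short root with all its translates occurs with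
all its translates. -/
lemma IsClosedLevel.mem_fullIndex_of_pairingIn_ne_zero (hm : IsTwist P m)
    (hZ : IsClosedLevel P m Z) {i j : ι} (hi : i ∈ fullIndex P m Z) (his : IsShort P i)
    {a : ℤ} (ha : a ∈ Z j) (h : P.pairingIn ℤ j i ≠ 0) : j ∈ fullIndex P m Z := by
  have hall : ∀ t, t ∈ Z i := fun t => hi fun hl => absurd hl (hm.not_isLong his)
  have hneg : ∀ t, t ∈ Z (P.reflectionPerm i i) := fun t => by
    have := hZ.refl_mem i i t (hall t) (3 * t) (hall _)
    rw [P.pairingIn_same] at this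
    convert this using 1
    ring
  have hshift : ∀ t, a + P.pairingIn ℤ j i * t ∈ Z j := fun t => by
    have := hZ.refl_mem i _ 0 (hall 0) _ (hZ.refl_mem i j (-t) (hall _) a ha)
    rw [P.reflectionPerm_self] at this
    convert this using 1
    ring
  suffices hdvd : (∀ k ∈ realLevel P m j, P.pairingIn ℤ j i ∣ k - a) ∨ ∀ t, t ∈ Z j by
    rcases hdvd with hdvd | hdvd
    · intro k hk
      obtain ⟨t, ht⟩ := hdvd k hk
      have := hshift t
      rwa [← ht, add_sub_cancel] at this
    · exact fun k _ => hdvd k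
  rcases isShort_or_isLong (P := P) j with hj | hj
  · rcases pairingIn_of_rootForm_eq (hj.rootForm_eq his) with h0 | h1 | h1 | rfl | h1
    · exact absurd h0 h
    · simp [h1.1]
    · simp [h1.1]
    · exact Or.inr hall
    · right
      have : P.reflectionPerm i i = j := by
        apply P.root.injective
        rw [root_reflectionPerm_self, ← h1, root_reflectionPerm_self, neg_neg]
      exact this ▸ hneg
  · left
    intro k hk
    have h1 : P.pairingIn ℤ i j ≠ 0 := fun h0 => h (pairingIn_eq_zero_symm h0)
    have h2 := dvd_sub (hk hj) (hZ.le j ha hj)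
    rw [hm.pairingIn_long_short hj his]
    rcases (hm.pairingIn_short_long hj his h1).1 with h3 | h3 <;> simpa [h3] using h2

/-- The lift of a maximal closed subroot system with a short root is maximal closed. If a closed
`Z` contains the lift of `I` and is not everything, then `I` is the set of roots all of whose
translates are in `Z`, so a root `i ∉ I` that occurs in `Z` is orthogonal to all short roots `c`
of `I`; it is even strongly orthogonal to them, as `i + c`, if a root, would be in `I`. -/
lemma IsClosedLevel.eq_liftLevel (hm : IsTwist P m) [P.IsRootSystem] {I : Set ι}
    (hI : IsClosedIndex P I)
    (hmax : ∀ J, IsClosedIndex P J → I ⊆ J → J ≠ Set.univ → J = I) {c : ι} (hc : c ∈ I)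
    (hcs : IsShort P c) (hZ : IsClosedLevel P m Z) (hIZ : liftLevel P m I ≤ Z)
    (hne : Z ≠ realLevel P m) : Z = liftLevel P m I := by
  have hIT : I ⊆ fullIndex P m Z := fun i hi k hk => hIZ i ⟨hi, hk⟩
  have hTI : fullIndex P m Z = I := by
    refine hmax _ (hZ.isClosedIndex_fullIndex hm ⟨c, hIT hc⟩) hIT fun h => hne ?_
    exact le_antisymm hZ.le fun i => (h ▸ Set.mem_univ i : i ∈ fullIndex P m Z)
  refine le_antisymm (fun i a ha => ⟨?_, hZ.le i ha⟩) hIZ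
  by_contra hi
  refine hi (strongOrthogonal_subset hm hI hmax hc hcs ?_)
  rintro d ⟨hd, hds⟩
  have h0 : P.pairingIn ℤ i d = 0 := by
    by_contra h
    exact hi (hTI ▸ hZ.mem_fullIndex_of_pairingIn_ne_zero hm (hIT hd) hds ha h)
  refine ⟨h0, fun k hk => hi ?_⟩
  have hkI : k ∈ I := by
    rw [← hTI]
    intro t ht
    have := hZ.add_mem i d k hk a ha (t - a)
      (hIT hd fun hl => absurd hl (hm.not_isLong hds)) (by simpa using ht)
    simpa using this
  refine hI.add_mem k hkI _ (hI.neg_mem hd) i ?_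
  rw [root_reflectionPerm_self, hk]
  abel

end MaximalLift

/-! ### Linear functions on the root lattice -/

section Linear

variable [P.IsCrystallographic] {p : ι → ℤ}

omit [Fintype ι] in
lemma IsZLinear.reflectionPerm (hp : IsZLinear P p) (i j : ι) :
    p (P.reflectionPerm i j) = p j - P.pairingIn ℤ j i * p i := by
  obtain ⟨f, hf⟩ := hp
  rw [hf, hf, hf, ← smul_eq_mul, ← map_smul, ← map_sub]
  congr 1
  ext
  simpa using root_reflectionPerm_int i j

omit [Fintype ι] [P.IsCrystallographic] in
lemma IsZLinear.add (hp : IsZLinear P p) {i j k : ι} (h : P.root k = P.root i + P.root j) :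
    p k = p i + p j := by
  obtain ⟨f, hf⟩ := hp
  rw [hf, hf, hf, ← map_add]
  congr 1
  ext
  simpa using h

omit [Fintype ι] in
lemma IsZLinear.isReflCompatible (hp : IsZLinear P p) : IsReflCompatible P p :=
  fun i j => (hp.reflectionPerm i j).symm

variable {Z : ι → Set ℤ}

/-- If every root occurs in `Z`, then some `ℤ`-linear function selects an element of each `Z i`:
prescribe it on a base, and note that membership is preserved by reflections. -/
lemma IsClosedLevel.exists_isZLinear [P.IsRootSystem] [P.IsReduced] (hZ : IsClosedLevel P m Z)
    (hne : ∀ i, (Z i).Nonempty) : ∃ p, IsZLinear P p ∧ ∀ i, p i ∈ Z i := by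
  obtain ⟨b⟩ := P.nonempty_base
  choose q hq using hne
  let f : P.rootSpan ℤ →ₗ[ℤ] ℤ := b.toWeightBasisInt.constr ℤ fun i => q i
  let p : ι → ℤ := fun i => f ⟨P.root i, Submodule.subset_span (Set.mem_range_self i)⟩
  have hp : IsZLinear P p := ⟨f, fun _ => rfl⟩
  have hbase : ∀ j ∈ b.support, p j ∈ Z j := fun j hj => by
    have h : (⟨P.root j, Submodule.subset_span (Set.mem_range_self j)⟩ : P.rootSpan ℤ) =
        b.toWeightBasisInt ⟨j, hj⟩ := by
      ext
      simp
    have h2 : p j = q j := by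
      simp only [p, f]
      rw [h, Module.Basis.constr_basis]
    rw [h2]
    exact hq j
  refine ⟨p, hp, fun i => b.induction_reflect i (fun j hj => ?_) hbase fun j k hj hk => ?_⟩
  · rw [hp.reflectionPerm]
    exact hZ.refl_mem j j _ hj _ hj
  · rw [hp.reflectionPerm]
    exact hZ.refl_mem k j _ (hbase k hk) _ hj

/-- Translating by a `ℤ`-linear function divisible by `m` at long roots is an automorphism of the
affine root system. -/
lemma IsClosedLevel.translate (hZ : IsClosedLevel P m Z) (hp : IsZLinear P p)
    (hpm : ∀ i, IsLong P i → (m : ℤ) ∣ p i) :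
    IsClosedLevel P m fun i => {k | k + p i ∈ Z i} where
  nonempty := by
    obtain ⟨i, k, hk⟩ := hZ.nonempty
    exact ⟨i, k - p i, by simpa using hk⟩
  le i k hk hi := (dvd_add_left (hpm i hi)).1 (hZ.le i hk hi)
  refl_mem i j a ha b hb := by
    have := hZ.refl_mem i j _ ha _ hb
    simp only [Set.mem_ofPred_eq]
    convert this using 1
    rw [hp.reflectionPerm]
    ring
  add_mem i j k h a ha b hb hab := by
    have hsum : a + b + p k = a + p i + (b + p j) := by
      rw [hp.add h]
      ring
    simp only [Set.mem_ofPred_eq, hsum]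
    exact hZ.add_mem i j k h _ ha _ hb fun hk => hsum ▸ dvd_add (hab hk) (hpm k hk)

end Linear

/-! ### Closed subroot systems in which every root occurs -/

section Periodic

variable {p : ι → ℤ}

/-- The family of all real roots `α + k δ` with `k ≡ p_α` modulo `d`. -/
def periodicLevel (P : RootPairing ι ℝ V N) (m : ℕ) (p : ι → ℤ) (d : ℕ) (i : ι) : Set ℤ :=
  {k | (d : ℤ) ∣ k - p i ∧ k ∈ realLevel P m i}

lemma mem_periodicLevel_self (hpm : ∀ i, IsLong P i → (m : ℤ) ∣ p i) (d : ℕ) (i : ι) :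
    p i ∈ periodicLevel P m p d i := ⟨by simp, hpm i⟩

lemma periodicLevel_mono {d n : ℕ} (h : n ∣ d) :
    periodicLevel P m p d ≤ periodicLevel P m p n :=
  fun _ _ hk => ⟨(Int.natCast_dvd_natCast.2 h).trans hk.1, hk.2⟩

variable [P.IsCrystallographic] {Z : ι → Set ℤ}

lemma IsClosedLevel.reflectionPerm_mem (hZ : IsClosedLevel P m Z) (h0 : ∀ i, 0 ∈ Z i) (i : ι)
    {j : ι} {a : ℤ} (ha : a ∈ Z j) : a ∈ Z (P.reflectionPerm i j) := by
  simpa using hZ.refl_mem i j 0 (h0 i) a ha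

lemma IsClosedLevel.add_pairingIn_mul_mem (hZ : IsClosedLevel P m Z) (h0 : ∀ i, 0 ∈ Z i)
    {i j : ι} {a b : ℤ} (ha : a ∈ Z i) (hb : b ∈ Z j) : b + P.pairingIn ℤ j i * a ∈ Z j := by
  have h1 := hZ.refl_mem i _ a ha _ (hZ.reflectionPerm_mem h0 i hb)
  rw [P.reflectionPerm_self] at h1
  rwa [← P.pairingIn_reflectionPerm ℤ, P.pairingIn_reflectionPerm_self_right, neg_mul,
    sub_neg_eq_add] at h1

variable [P.IsIrreducible]

lemma IsClosedLevel.eq_of_rootForm_eq (hZ : IsClosedLevel P m Z) (h0 : ∀ i, 0 ∈ Z i)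
    {i j : ι} (h : P.RootForm (P.root i) (P.root i) = P.RootForm (P.root j) (P.root j)) :
    Z i = Z j := by
  ext a
  exact ⟨fun ha => of_rootForm_eq (Q := fun l => a ∈ Z l)
      (fun k l => hZ.reflectionPerm_mem h0 k) ha h,
    fun ha => of_rootForm_eq (Q := fun l => a ∈ Z l)
      (fun k l => hZ.reflectionPerm_mem h0 k) ha h.symm⟩

variable [P.IsReduced] [P.IsRootSystem]

omit [P.IsCrystallographic] [P.IsReduced] in
lemma periodicLevel_eq_realLevel_iff (hm : IsTwist P m) {d : ℕ} :
    periodicLevel P m p d = realLevel P m ↔ d = 1 := by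
  constructor
  · intro h
    obtain ⟨i, hi⟩ := exists_isShort P
    have h1 : p i + 1 ∈ periodicLevel P m p d i := h ▸ fun hl => absurd hl (hm.not_isLong hi)
    have h2 : (d : ℤ) ∣ 1 := by simpa using h1.1
    exact_mod_cast Int.eq_one_of_dvd_one (by positivity) h2
  · rintro rfl
    ext i k
    simp [periodicLevel]

omit [P.IsCrystallographic] [P.IsReduced] in
lemma dvd_of_periodicLevel_le (hm : IsTwist P m) {d n : ℕ}
    (h : periodicLevel P m p n ≤ periodicLevel P m p d) : d ∣ n := by
  obtain ⟨i, hi⟩ := exists_isShort P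
  have h1 : p i + n ∈ periodicLevel P m p n i :=
    ⟨by simp, fun hl => absurd hl (hm.not_isLong hi)⟩
  have h2 := (h i h1).1
  rw [add_sub_cancel_left] at h2
  exact_mod_cast h2

/-- A closed subroot system containing the finite roots is determined by an integer `d`. The integers
occurring at a short root form a subgroup of `ℤ`, and those occurring at a long root are its
elements divisible by `m`; both are read off from short roots `i`, `j` whose sum `k` is long. -/
lemma IsClosedLevel.exists_dvd_iff (hm : IsTwist P m) (hZ : IsClosedLevel P m Z)
    (h0 : ∀ i, 0 ∈ Z i) :
    ∃ d : ℕ, ∀ i k, k ∈ Z i ↔ (d : ℤ) ∣ k ∧ k ∈ realLevel P m i := by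
  obtain ⟨hm23, i, j, k, hi, hj, hk, hkij, hik, hji⟩ := hm.exists_short_add_short
  have hZij : Z i = Z j := hZ.eq_of_rootForm_eq h0 (hi.rootForm_eq hj)
  have hshort : ∀ {a}, a ∈ realLevel P m i := fun h => absurd h (hm.not_isLong hi)
  have hki : ∀ {a}, a ∈ Z k → a ∈ Z i := fun {a} ha => by
    simpa [hik] using hZ.add_pairingIn_mul_mem h0 ha (h0 i)
  have hik' : ∀ {a b}, a ∈ Z i → b ∈ Z i → (m : ℤ) ∣ a + b → a + b ∈ Z k := fun ha hb h =>
    hZ.add_mem i j k hkij _ ha _ (hZij ▸ hb) fun _ => h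
  have hadd : ∀ {a b}, a ∈ Z i → b ∈ Z i → a + b ∈ Z i := by
    intro a b ha hb
    rcases hm23 with rfl | rfl
    · -- If `a + b` is odd, one of the two is even and so occurs at `k`, with `⟨i, kᵛ⟩ = 1`.
      have hmove : ∀ {a b}, a ∈ Z i → b ∈ Z i → (2 : ℤ) ∣ a → b + a ∈ Z i := fun {a b} ha hb h => by
        have := hik' ha (h0 i) (by simpa using h)
        simpa [hik] using hZ.add_pairingIn_mul_mem h0 this hb
      rcases Int.even_or_odd a with h | h
      · rw [add_comm]
        exact hmove ha hb h.two_dvd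
      rcases Int.even_or_odd b with h' | h'
      · exact hmove hb ha h'.two_dvd
      · exact hki (hik' ha hb (h.add_odd h').two_dvd)
    · have := hZ.add_pairingIn_mul_mem h0 ha (hZij ▸ hb : b ∈ Z j)
      rw [hji, ← hZij] at this
      convert this using 1
      push_cast
      ring
  have hneg : ∀ {a}, a ∈ Z i → -a ∈ Z i := fun {a} ha => by
    have := hZ.refl_mem i i a ha a ha
    rw [P.pairingIn_same] at this
    have h2 := hZ.reflectionPerm_mem h0 i this
    rw [P.reflectionPerm_self] at h2
    convert h2 using 1
    ring
  let G : AddSubgroup ℤ :=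
    { carrier := Z i, add_mem' := hadd, zero_mem' := h0 i, neg_mem' := hneg }
  obtain ⟨d, hd⟩ := Int.subgroup_cyclic G
  have hdi : ∀ a, a ∈ Z i ↔ (d.natAbs : ℤ) ∣ a := fun a => by
    rw [Int.natAbs_dvd]
    have : a ∈ G ↔ d ∣ a := by
      rw [hd, AddSubgroup.mem_closure_singleton, dvd_iff_exists_eq_mul_left]
      simp [eq_comm]
    exact this
  refine ⟨d.natAbs, fun l a => ?_⟩
  rcases isShort_or_isLong (P := P) l with hl | hl
  · rw [hZ.eq_of_rootForm_eq h0 (hl.rootForm_eq hi), ← hdi]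
    exact ⟨fun h => ⟨h, fun h' => absurd h' (hm.not_isLong hl)⟩, And.left⟩
  · rw [hZ.eq_of_rootForm_eq h0 (hl.rootForm_eq hk), ← hdi]
    refine ⟨fun h => ⟨hki h, fun _ => hZ.le k h hk⟩, fun h => ?_⟩
    simpa using hik' h.1 (h0 i) (by simpa using h.2 hl)

lemma IsClosedLevel.exists_eq_periodicLevel (hm : IsTwist P m) (hZ : IsClosedLevel P m Z)
    (hp : IsZLinear P p) (hpZ : ∀ i, p i ∈ Z i) : ∃ d, Z = periodicLevel P m p d := by
  have hpm : ∀ i, IsLong P i → (m : ℤ) ∣ p i := fun i => hZ.le i (hpZ i)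
  obtain ⟨d, hd⟩ := (hZ.translate hp hpm).exists_dvd_iff hm fun i => by simpa using hpZ i
  refine ⟨d, funext fun i => Set.ext fun k => ?_⟩
  have := hd i (k - p i)
  simp only [Set.mem_ofPred_eq, sub_add_cancel] at this
  rw [this]
  exact and_congr_right fun _ => forall_congr' fun hi => (dvd_sub_left (hpm i hi))

lemma isClosedLevel_periodicLevel (hm : IsTwist P m) (hp : IsZLinear P p)
    (hpm : ∀ i, IsLong P i → (m : ℤ) ∣ p i) (d : ℕ) :
    IsClosedLevel P m (periodicLevel P m p d) where
  nonempty := (nonempty_index P).elim fun i => ⟨i, p i, by simp, hpm i⟩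
  le _ _ hk := hk.2
  refl_mem i j a ha b hb := by
    refine ⟨?_, sub_mem_realLevel_reflectionPerm hm ha.2 hb.2⟩
    have h : b - P.pairingIn ℤ j i * a - p (P.reflectionPerm i j) =
        b - p j - P.pairingIn ℤ j i * (a - p i) := by
      rw [hp.reflectionPerm]
      ring
    rw [h]
    exact dvd_sub hb.1 (ha.1.mul_left _)
  add_mem i j k h a ha b hb hab := by
    refine ⟨?_, hab⟩
    rw [hp.add h, add_sub_add_comm]
    exact dvd_add ha.1 hb.1

lemma IsTwist.periodicRoots_eq (hm : IsTwist P m) (hpm : ∀ i, IsLong P i → (m : ℤ) ∣ p i)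
    {n : ℕ} (hn : n.Prime) : periodicRoots P m p n = ofLevel P (periodicLevel P m p n) := by
  have hmp : m.Prime := by
    rcases hm.exists_short_add_short.1 with rfl | rfl <;> decide
  have hshort : ∀ {i k}, IsShort P i → k ∈ realLevel P m i :=
    fun hi hl => absurd hl (hm.not_isLong hi)
  rw [periodicRoots]
  split_ifs with hmn
  · subst hmn
    ext x
    constructor
    · rintro ⟨i, r, rfl⟩
      exact ⟨i, p i + r * m, ⟨by simp, fun hi => dvd_add (hpm i hi) (dvd_mul_left _ _)⟩, by simp⟩
    · rintro ⟨i, k, ⟨⟨r, hr⟩, -⟩, rfl⟩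
      refine ⟨i, r, ?_⟩
      rw [sub_eq_iff_eq_add.1 hr]
      push_cast
      ring_nf
  · have hcop : IsCoprime (m : ℤ) n :=
      Nat.isCoprime_iff_coprime.2 ((Nat.coprime_primes hmp hn).2 hmn)
    ext x
    constructor
    · rintro (⟨i, r, hi, rfl⟩ | ⟨i, r, hi, rfl⟩)
      · exact ⟨i, p i + r * n, ⟨by simp, hshort hi⟩, by simp⟩
      · refine ⟨i, p i + m * r * n, ⟨by simp, fun _ => ?_⟩, by simp⟩
        exact dvd_add (hpm i hi) ((dvd_mul_right _ _).mul_right _)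
    · rintro ⟨i, k, ⟨hk, hk'⟩, rfl⟩
      rcases isShort_or_isLong (P := P) i with hi | hi
      · obtain ⟨r, hr⟩ := hk
        refine Or.inl ⟨i, r, hi, ?_⟩
        rw [sub_eq_iff_eq_add.1 hr]
        push_cast
        ring_nf
      · obtain ⟨r, hr⟩ := hcop.mul_dvd (dvd_sub (hk' hi) (hpm i hi)) hk
        refine Or.inr ⟨i, r, hi, ?_⟩
        rw [sub_eq_iff_eq_add.1 hr]
        push_cast
        ring_nf

/-- If every root occurs in a maximal closed subroot system, the latter is periodic with a prime
period, because the one with period `d` is contained in those whose period divides `d`. -/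
lemma exists_prime_eq_periodicLevel (hm : IsTwist P m) (hZ : IsClosedLevel P m Z)
    (hne : Z ≠ realLevel P m)
    (hmax : ∀ Y, IsClosedLevel P m Y → Z ≤ Y → Y ≠ realLevel P m → Y = Z)
    (hfull : ∀ i, (Z i).Nonempty) :
    ∃ p n, IsZLinear P p ∧ (∀ i, IsLong P i → (m : ℤ) ∣ p i) ∧ n.Prime ∧
      Z = periodicLevel P m p n := by
  obtain ⟨p, hp, hpZ⟩ := hZ.exists_isZLinear hfull
  have hpm : ∀ i, IsLong P i → (m : ℤ) ∣ p i := fun i => hZ.le i (hpZ i)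
  obtain ⟨d, rfl⟩ := hZ.exists_eq_periodicLevel hm hp hpZ
  obtain ⟨n, hn, hnd⟩ :=
    Nat.exists_prime_and_dvd ((periodicLevel_eq_realLevel_iff hm).not.1 hne)
  exact ⟨p, n, hp, hpm, hn, (hmax _ (isClosedLevel_periodicLevel hm hp hpm n)
    (periodicLevel_mono hnd) ((periodicLevel_eq_realLevel_iff hm).not.2 hn.ne_one)).symm⟩

lemma eq_periodicLevel_of_le (hm : IsTwist P m) (hp : IsZLinear P p)
    (hpm : ∀ i, IsLong P i → (m : ℤ) ∣ p i) {n : ℕ} (hn : n.Prime) {Y : ι → Set ℤ}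
    (hY : IsClosedLevel P m Y) (hle : periodicLevel P m p n ≤ Y) (hne : Y ≠ realLevel P m) :
    Y = periodicLevel P m p n := by
  obtain ⟨d, rfl⟩ :=
    hY.exists_eq_periodicLevel hm hp fun i => hle i (mem_periodicLevel_self hpm n i)
  rcases (Nat.dvd_prime hn).1 (dvd_of_periodicLevel_le hm hle) with h | h
  · exact absurd ((periodicLevel_eq_realLevel_iff hm).2 h) hne
  · rw [h]

end Periodic

end AffRoot

theorem mainTheorem2 {ι V N : Type*} [Fintype ι] [AddCommGroup V] [Module ℝ V]
    [AddCommGroup N] [Module ℝ N] (P : RootPairing ι ℝ V N) [P.IsRootSystem]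
    [P.IsCrystallographic] [P.IsReduced] [P.IsIrreducible]
    (m : ℕ) (hm : AffRoot.IsTwist P m) :
    (∀ Ψ : Set (V × ℝ),
      AffRoot.IsMaximalClosed (AffRoot.affineForm P) (AffRoot.realRoots P m) Ψ →
      AffRoot.gradient Ψ = AffRoot.finiteRoots P →
      ∃ (p : ι → ℤ) (n : ℕ), AffRoot.IsZLinear P p ∧ AffRoot.IsReflCompatible P p ∧
        (∀ i, AffRoot.IsLong P i → (m : ℤ) ∣ p i) ∧ n.Prime ∧
        Ψ = AffRoot.periodicRoots P m p n) ∧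
    (∀ (p : ι → ℤ) (n : ℕ), AffRoot.IsZLinear P p → AffRoot.IsReflCompatible P p →
      (∀ i, AffRoot.IsLong P i → (m : ℤ) ∣ p i) → n.Prime →
      AffRoot.IsMaximalClosed (AffRoot.affineForm P) (AffRoot.realRoots P m)
          (AffRoot.periodicRoots P m p n) ∧
        AffRoot.gradient (AffRoot.periodicRoots P m p n) = AffRoot.finiteRoots P) ∧
    (∀ Ψ : Set (V × ℝ),
      AffRoot.IsMaximalClosed (AffRoot.affineForm P) (AffRoot.realRoots P m) Ψ →
      AffRoot.IsClosedSubrootSystem P.RootForm (AffRoot.finiteRoots P) (AffRoot.gradient Ψ) →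
      AffRoot.gradient Ψ ≠ AffRoot.finiteRoots P →
      AffRoot.IsMaximalClosed P.RootForm (AffRoot.finiteRoots P) (AffRoot.gradient Ψ) ∧
        (∃ i, AffRoot.IsShort P i ∧ P.root i ∈ AffRoot.gradient Ψ) ∧
        Ψ = AffRoot.lift P m (AffRoot.gradient Ψ)) ∧
    (∀ S : Set V,
      AffRoot.IsMaximalClosed P.RootForm (AffRoot.finiteRoots P) S →
      (∃ i, AffRoot.IsShort P i ∧ P.root i ∈ S) →
      AffRoot.IsMaximalClosed (AffRoot.affineForm P) (AffRoot.realRoots P m)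
        (AffRoot.lift P m S)) := by
  open AffRoot in
  refine ⟨fun Ψ hΨ hgr => ?_, fun p n hp _ hpm hn => ?_, fun Ψ hΨ hgr hne => ?_,
    fun S hS hshort => ?_⟩
  · obtain ⟨Z, rfl⟩ := hm.exists_ofLevel hΨ.1.1.subset
    obtain ⟨hZ, hne, hmax⟩ := hm.isMaximalClosed_ofLevel_iff.1 hΨ
    rw [gradient_ofLevel, image_root_eq_finiteRoots_iff] at hgr
    obtain ⟨p, n, hp, hpm, hn, rfl⟩ := exists_prime_eq_periodicLevel hm hZ hne hmax
      fun i => (hgr ▸ Set.mem_univ i : i ∈ {i | (Z i).Nonempty})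
    exact ⟨p, n, hp, hp.isReflCompatible, hpm, hn, (hm.periodicRoots_eq hpm hn).symm⟩
  · rw [hm.periodicRoots_eq hpm hn, hm.isMaximalClosed_ofLevel_iff, gradient_ofLevel,
      image_root_eq_finiteRoots_iff]
    exact ⟨⟨isClosedLevel_periodicLevel hm hp hpm n,
      (periodicLevel_eq_realLevel_iff hm).not.2 hn.ne_one,
      fun Y hY hle hne => eq_periodicLevel_of_le hm hp hpm hn hY hle hne⟩,
      Set.eq_univ_of_forall fun i => ⟨p i, mem_periodicLevel_self hpm n i⟩⟩
  · obtain ⟨Z, rfl⟩ := hm.exists_ofLevel hΨ.1.1.subset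
    obtain ⟨hZ, -, hmax⟩ := hm.isMaximalClosed_ofLevel_iff.1 hΨ
    rw [gradient_ofLevel] at hgr hne ⊢
    rw [Ne, image_root_eq_finiteRoots_iff] at hne
    rw [isClosedSubrootSystem_image_iff] at hgr
    obtain ⟨h1, h2, i, hi, his⟩ := isMaximal_gradient hm hZ hmax rfl hgr hne
    exact ⟨isMaximalClosed_image_iff.2 ⟨hgr, hne, h2⟩, ⟨i, his, Set.mem_image_of_mem _ hi⟩,
      by rw [hm.lift_eq, ← h1]⟩
  · obtain ⟨I, rfl⟩ := Set.subset_range_iff_exists_image_eq.1 hS.1.1.subset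
    obtain ⟨hI, hne, hmax⟩ := isMaximalClosed_image_iff.1 hS
    obtain ⟨c, hcs, hc⟩ := hshort
    rw [P.root.injective.mem_set_image] at hc
    rw [hm.lift_eq, hm.isMaximalClosed_ofLevel_iff]
    exact ⟨hI.isClosedLevel_lift hm, liftLevel_ne_realLevel hne,
      fun Y hY hle hYne => hY.eq_liftLevel hm hI hmax hc hcs hle hYne⟩
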